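/- Let $\Lambda,\Omega$ be countably infinite sets, let $\mathcal F$ be a nonempty family of infinite subsets of $\Omega$ such that $F\setminus K\in\mathcal F$ for all $F\in\mathcal F$ and all finite $K\subseteq\Omega$, and let $\rho$ be a function assigning to each $F\in\mathcal F$ an infinite set $\rho(F)\subseteq\Lambda$. Assume that $\rho$ is *partition regular*, that is: - (M) if $E,F\in\mathcal F$ and $E\subseteq F$, then $\rho(E)\subseteq\rho(F)$; - (R) if $F\in\mathcal F$ and $\rho(F)=A\cup B$, then there is $E\in\mathcal F$ with $\rho(E)\subseteq A$ or $\rho(E)\subseteq B$; - (S) for every $E\in\mathcal F$ there is $F\in\mathcal F$ with $F\subseteq E$ such that for every $a\in\rho(F)$ there is a finite $K\subseteq\Omega$ with $a\notin\rho(F\setminus K)$. Put $\mathcal I_\rho=\{A\subseteq\Lambda:\rho(F)\not\subseteq A\text{ for all }F\in\mathcal F\}$. We say that $\rho$ *has small accretions* if for every $E\in\mathcal F$ there is $F\in\mathcal F$ with $F\subseteq E$ such that $\rho(F)\setminus\rho(F\setminus K)\in\mathcal I_\rho$ for every finite $K\subseteq\Omega$. We write $\rho\in P^-$ if for every decreasing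 sequence $A_0\supseteq A_1\supseteq\cdots$ of subsets of $\Lambda$ with $A_0\notin\mathcal I_\rho$ and $A_n\setminus A_{n+1}\in\mathcal I_\rho$ for all $n$ there is $F\in\mathcal F$ such that $\rho(F)\subseteq A_0$ and for each $n$ there is a finite $K\subseteq\Omega$ with $\rho(F\setminus K)\subseteq A_n$. A topological space $X$ belongs to $\mathrm{FinBW}(\rho)$ if for every $f:\Lambda\to X$ there are $F\in\mathcal F$ and $x\in X$ such that for every neighbourhood $U$ of $x$ there is a finite $K\subseteq\Omega$ with $f[\rho(F\setminus K)]\subseteq U$. Let $\mathrm{conv}$ be the family of all subsets of $\mathbb Q\cap[0,1]$ that can be covered by the ranges of finitely many sequences in $\mathbb Q\cap[0,1]$ convergent in $[0,1]$. We write $\rho_{\mathrm{conv}}\le_K\rho$ if there is a function $f:\Lambda\to\mathbb Q\cap[0,1]$ such that for every $F_1\in\mathcal F$ there is $F_2\subseteq\mathbb Q\cap[0,1]$ with $F_2\notin\mathrm{conv}$ such that for every finite $K_1\subseteq\Omega$ there is a finite $K_2\subseteq\mathbb Q\cap[0,1]$ with $F_2\setminus K_2\subseteq f[\rho(F_1\setminus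 K_1)]$. (This is the Katětov order between $\rho$ and the function $\rho_{\mathrm{conv}}(A)=A$ defined on the sets $A\notin\mathrm{conv}$.) **Theorem.** Let $\rho$ be partition regular with small accretions. If moreover $\rho\in P^-$, then the following conditions are equivalent: 1. for every metric space $X$: $X\in\mathrm{FinBW}(\rho)$ if and only if $X$ is compact; 2. $[0,1]\in\mathrm{FinBW}(\rho)$; 3. $\rho_{\mathrm{conv}}\not\le_K\rho$. The assumption $\rho\in P^-$ is used only for $(3)\Rightarrow(2)$: without it, $(1)\Leftrightarrow(2)$ and $(2)\Rightarrow(3)$ still hold. -/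

import Mathlib

open Set Filter Topology

universe u v w

/-- A partial function `ρ : 𝓕 → [Λ]^ω` with `𝓕 ⊆ [Ω]^ω` is represented by its domain `𝓕` and a map
`ρ : Set Ω → Set Λ`, of which only the values on `𝓕` are ever used.
`IsPartitionRegular 𝓕 ρ` says that `𝓕` is a nonempty family of infinite sets closed under removing
finite sets, that `ρ` takes infinite values on `𝓕`, and that (M), (R) and (S) hold. -/
structure IsPartitionRegular {Ω Λ : Type*} (𝓕 : Set (Set Ω)) (ρ : Set Ω → Set Λ) : Prop where
  nonempty : 𝓕.Nonempty
  infinite_mem : ∀ F ∈ 𝓕, F.Infinite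
  diff_mem : ∀ F ∈ 𝓕, ∀ K : Finset Ω, F \ (K : Set Ω) ∈ 𝓕
  infinite_value : ∀ F ∈ 𝓕, (ρ F).Infinite
  /-- property (M) -/
  mono : ∀ E ∈ 𝓕, ∀ F ∈ 𝓕, E ⊆ F → ρ E ⊆ ρ F
  /-- property (R) -/
  ramsey : ∀ F ∈ 𝓕, ∀ A B : Set Λ, ρ F = A ∪ B → ∃ E ∈ 𝓕, ρ E ⊆ A ∨ ρ E ⊆ B
  /-- property (S) -/
  sparse : ∀ E ∈ 𝓕, ∃ F ∈ 𝓕, F ⊆ E ∧ ∀ a ∈ ρ F, ∃ K : Finset Ω, a ∉ ρ (F \ (K : Set Ω))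

/-- The ideal `I_ρ = {A ⊆ Λ : ρ(F) ⊄ A for all F ∈ 𝓕}`. -/
def rhoIdeal {Ω Λ : Type*} (𝓕 : Set (Set Ω)) (ρ : Set Ω → Set Λ) : Set (Set Λ) :=
  {A | ∀ F ∈ 𝓕, ¬ ρ F ⊆ A}

/-- A single set `F` has small accretions. -/
def SetHasSmallAccretions {Ω Λ : Type*} (𝓕 : Set (Set Ω)) (ρ : Set Ω → Set Λ) (F : Set Ω) : Prop :=
  ∀ K : Finset Ω, ρ F \ ρ (F \ (K : Set Ω)) ∈ rhoIdeal 𝓕 ρ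

/-- `ρ` has small accretions. -/
def HasSmallAccretions {Ω Λ : Type*} (𝓕 : Set (Set Ω)) (ρ : Set Ω → Set Λ) : Prop :=
  ∀ E ∈ 𝓕, ∃ F ∈ 𝓕, F ⊆ E ∧ SetHasSmallAccretions 𝓕 ρ F

/-- The property `ρ ∈ P⁻`. -/
def PMinus {Ω Λ : Type*} (𝓕 : Set (Set Ω)) (ρ : Set Ω → Set Λ) : Prop :=
  ∀ A : ℕ → Set Λ, Antitone A → A 0 ∉ rhoIdeal 𝓕 ρ →
    (∀ n, A n \ A (n + 1) ∈ rhoIdeal 𝓕 ρ) →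
    ∃ F ∈ 𝓕, ρ F ⊆ A 0 ∧ ∀ n, ∃ K : Finset Ω, ρ (F \ (K : Set Ω)) ⊆ A n

/-- `f ↾ ρ(F)` is `ρ`-convergent to `x`. -/
def RhoConvergesTo {Ω Λ X : Type*} [TopologicalSpace X] (ρ : Set Ω → Set Λ) (f : Λ → X)
    (F : Set Ω) (x : X) : Prop :=
  ∀ U ∈ 𝓝 x, ∃ K : Finset Ω, f '' ρ (F \ (K : Set Ω)) ⊆ U

/-- The topological space `X` belongs to the class `FinBW(ρ)`. -/
def FinBW {Ω Λ : Type*} (𝓕 : Set (Set Ω)) (ρ : Set Ω → Set Λ) (X : Type*) [TopologicalSpace X] :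
    Prop :=
  ∀ f : Λ → X, ∃ F ∈ 𝓕, ∃ x : X, RhoConvergesTo ρ f F x

/-- The Katětov order: `KatetovLE 𝓕₂ ρ₂ 𝓕₁ ρ₁` means `ρ₂ ≤_K ρ₁`. -/
def KatetovLE {Ω₁ Λ₁ Ω₂ Λ₂ : Type*} (𝓕₂ : Set (Set Ω₂)) (ρ₂ : Set Ω₂ → Set Λ₂)
    (𝓕₁ : Set (Set Ω₁)) (ρ₁ : Set Ω₁ → Set Λ₁) : Prop :=
  ∃ f : Λ₁ → Λ₂, ∀ F₁ ∈ 𝓕₁, ∃ F₂ ∈ 𝓕₂, ∀ K₁ : Finset Ω₁, ∃ K₂ : Finset Ω₂,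
    ρ₂ (F₂ \ (K₂ : Set Ω₂)) ⊆ f '' ρ₁ (F₁ \ (K₁ : Set Ω₁))

/-- The coideal `I⁺`, i.e. the domain of the function `ρ_I`. -/
def coideal {Λ : Type*} (I : Set (Set Λ)) : Set (Set Λ) :=
  {A | A ∉ I}

/-- The function `ρ_I : I⁺ → [Λ]^ω`, `ρ_I(A) = A`; its domain is `coideal I`. -/
def rhoOfIdeal {Λ : Type*} (_I : Set (Set Λ)) : Set Λ → Set Λ :=
  fun A => A

/-- The ideal `conv` on `ℚ ∩ [0,1]`: the sets covered by the ranges of finitely many sequences in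
`ℚ ∩ [0,1]` that converge in the real interval `[0,1]`. -/
def convIdeal : Set (Set (Icc (0 : ℚ) 1)) :=
  {A | ∃ (n : ℕ) (s : Fin n → ℕ → Icc (0 : ℚ) 1),
    (∀ i, ∃ p ∈ Icc (0 : ℝ) 1, Tendsto (fun k => (((s i k : ℚ)) : ℝ)) atTop (𝓝 p)) ∧
    A ⊆ ⋃ i, range (s i)}

/-! Call the filter generated by the sets `ρ(F ∖ K)`, `K` finite, the tail filter of `F`. Then
`FinBW(ρ)` says that every map to `X` converges along some tail filter, and `ρ_conv ≤_K ρ` says that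
there is a map `g` to `ℚ ∩ [0,1]` such that the image of each tail filter under `g` has a
pseudo-intersection outside `conv`. Since the range of a convergent sequence has at most one
accumulation point, a set in `conv` has finitely many of them, and a set that converges to a point
is in `conv`; this is `(2) ⇒ (3)`. Compact metric spaces are continuous images of the Cantor set,
whence `(2) ⇒ (1)`.

For `(3) ⇒ (2)`, a map to `[0,1]` without `ρ`-limits may be assumed rational-valued because (S)
makes some tail filter finer than the cofinite filter. Consider its cluster points along
`I_ρ`-positive subsets of `ρ(F)`. An isolated one would be a `ρ`-limit by `P⁻`, so compactness
yields infinitely many. By small accretions all of them are accumulation points along the tail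
filter of `F`, and a diagonal argument produces a pseudo-intersection accumulating at infinitely
many of them, which is therefore not in `conv`. -/

section Topology

theorem mem_cofinite_inf_principal {α : Type*} {s t : Set α} :
    s ∈ cofinite ⊓ 𝓟 t ↔ (t \ s).Finite := by
  have hcompl : {x | x ∈ t → x ∈ s}ᶜ = t \ s := by grind
  rw [mem_inf_principal, mem_cofinite, hcompl]

theorem derivedSet_range_subset_of_tendsto {X : Type*} [TopologicalSpace X] [T2Space X]
    {u : ℕ → X} {p : X} (hu : Tendsto u atTop (𝓝 p)) : derivedSet (range u) ⊆ {p} := by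
  intro x hx
  have hcof : cofinite ⊓ 𝓟 (range u) ≤ map u cofinite := by
    intro s hs
    refine mem_cofinite_inf_principal.2 ((Finite.image u hs).subset ?_)
    rintro _ ⟨⟨k, rfl⟩, hk⟩
    exact ⟨k, hk, rfl⟩
  have hle : 𝓝[≠] x ⊓ 𝓟 (range u) ≤ 𝓝 x ⊓ 𝓝 p := by
    refine le_inf (inf_le_left.trans nhdsWithin_le_nhds) ?_
    refine (inf_le_inf_right _ (nhdsNE_le_cofinite x)).trans (hcof.trans ?_)
    rwa [Nat.cofinite_eq_atTop]
  exact eq_of_nhds_neBot (NeBot.mono hx hle)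

theorem derivedSet_iUnion_of_finite {X ι : Type*} [TopologicalSpace X] [Finite ι] (s : ι → Set X) :
    derivedSet (⋃ i, s i) = ⋃ i, derivedSet (s i) := by
  ext x
  simp only [mem_iUnion, mem_derivedSet, accPt_iff_frequently_nhdsNE, frequently_exists]

theorem exists_inf_principal_le_nhds_of_finite_clusterPt {X : Type*} [TopologicalSpace X]
    [CompactSpace X] [T2Space X] {l : Filter X} [l.NeBot] (hl : {x | ClusterPt x l}.Finite) :
    ∃ c, ∃ V : Set X, (l ⊓ 𝓟 V).NeBot ∧ l ⊓ 𝓟 V ≤ 𝓝 c := by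
  obtain ⟨c, hc⟩ := exists_clusterPt_of_compactSpace l
  have hnhds : ({x | ClusterPt x l} \ {c})ᶜ ∈ 𝓝 c :=
    hl.sdiff.isClosed.isOpen_compl.mem_nhds fun h => h.2 rfl
  obtain ⟨V, hV, hVclosed, hVsub⟩ := exists_mem_nhds_isClosed_subset hnhds
  refine ⟨c, V, ?_, ?_⟩
  · rw [inf_comm]
    exact NeBot.mono hc (inf_le_inf_right l (le_principal_iff.2 hV))
  refine hVclosed.isCompact.le_nhds_of_unique_clusterPt
    (mem_inf_of_right (mem_principal_self V)) fun x hxV hx => ?_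
  by_contra hne
  exact hVsub hxV ⟨hx.of_inf_left, hne⟩

theorem exists_tendsto_dist_of_denseRange {Λ X Y : Type*} [Countable Λ] [PseudoMetricSpace X]
    {i : Y → X} (hi : DenseRange i) (f : Λ → X) :
    ∃ g : Λ → Y, Tendsto (fun a => dist (f a) (i (g a))) cofinite (𝓝 0) := by
  obtain ⟨e, he⟩ := exists_injective_nat Λ
  choose g hg using fun a => hi.exists_dist_lt (f a) (Nat.one_div_pos_of_nat (α := ℝ) (n := e a))
  have hlim : Tendsto (fun a => 1 / ((e a : ℝ) + 1)) cofinite (𝓝 0) :=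
    tendsto_one_div_add_atTop_nhds_zero_nat.comp (Nat.cofinite_eq_atTop ▸ he.tendsto_cofinite)
  exact ⟨g, squeeze_zero (fun _ => dist_nonneg) (fun a => (hg a).le) hlim⟩

/-- The diagonal set consists of the points `y j k ∈ B j`, where `y j` is a sequence converging
along `m j` and `B` is a decreasing basis of `l`. -/
theorem exists_cofinite_inf_principal_le {Y : Type*} {l : Filter Y} [l.IsCountablyGenerated]
    {m : ℕ → Filter Y} [∀ j, (m j).IsCountablyGenerated] [∀ j, (m j).NeBot] (hm : ∀ j, m j ≤ l) :
    ∃ A : Set Y, cofinite ⊓ 𝓟 A ≤ l ∧ ∀ j, (m j ⊓ 𝓟 A).NeBot := by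
  obtain ⟨B, hB⟩ := l.exists_antitone_basis
  choose y hy using fun j => exists_seq_tendsto (m j)
  refine ⟨⋃ j, range (y j) ∩ B j, fun s hs => ?_, fun j => ?_⟩
  · obtain ⟨n, hn⟩ := hB.mem_iff.1 hs
    have hfin (j : ℕ) : {k | y j k ∉ B n}.Finite := by
      have := ((hy j).mono_right (hm j)).eventually_mem (hB.mem n)
      rwa [← Nat.cofinite_eq_atTop] at this
    refine mem_cofinite_inf_principal.2
      (((finite_Iio n).biUnion fun j _ => (hfin j).image (y j)).subset ?_)
    rintro a ⟨haA, has⟩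
    obtain ⟨j, ⟨k, rfl⟩, hj⟩ := mem_iUnion.1 haA
    have hjn : j < n := lt_of_not_ge fun hnj => has (hn (hB.antitone hnj hj))
    exact mem_biUnion hjn ⟨k, fun h => has (hn h), rfl⟩
  · have hyB : ∀ᶠ k in atTop, y j k ∈ B j :=
      ((hy j).mono_right (hm j)).eventually_mem (hB.mem j)
    refine Tendsto.neBot (f := y j) (x := atTop) (tendsto_inf.2 ⟨hy j, tendsto_principal.2 ?_⟩)
    exact hyB.mono fun k hk => mem_iUnion.2 ⟨j, mem_range_self k, hk⟩

end Topology

section ConvIdeal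

/-- The inclusion of `ℚ ∩ [0,1]` into the real interval `[0,1]`. -/
def unitRatCast (q : Icc (0 : ℚ) 1) : Icc (0 : ℝ) 1 :=
  ⟨((q : ℚ) : ℝ), by exact_mod_cast q.2.1, by exact_mod_cast q.2.2⟩

theorem denseRange_unitRatCast : DenseRange unitRatCast := by
  refine dense_of_exists_between fun a b hab => ?_
  obtain ⟨q, haq, hqb⟩ := exists_rat_btwn (Subtype.coe_lt_coe.2 hab)
  have hq : q ∈ Icc (0 : ℚ) 1 :=
    ⟨by exact_mod_cast a.2.1.trans haq.le, by exact_mod_cast hqb.le.trans b.2.2⟩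
  exact ⟨unitRatCast ⟨q, hq⟩, mem_range_self _, haq, hqb⟩

theorem mem_convIdeal_iff {A : Set (Icc (0 : ℚ) 1)} :
    A ∈ convIdeal ↔ ∃ (n : ℕ) (s : Fin n → ℕ → Icc (0 : ℚ) 1),
      (∀ i, ∃ p, Tendsto (unitRatCast ∘ s i) atTop (𝓝 p)) ∧ A ⊆ ⋃ i, range (s i) := by
  simp only [convIdeal, mem_ofPred_eq, Subtype.exists, tendsto_subtype_rng, exists_prop]
  rfl

theorem mem_convIdeal_of_finite {A : Set (Icc (0 : ℚ) 1)} (hA : A.Finite) : A ∈ convIdeal := by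
  obtain ⟨n, s, -, rfl⟩ := hA.fin_param
  refine mem_convIdeal_iff.2 ⟨n, fun i _ => s i, fun i => ⟨_, tendsto_const_nhds⟩, ?_⟩
  rintro _ ⟨i, rfl⟩
  exact mem_iUnion.2 ⟨i, 0, rfl⟩

theorem mem_convIdeal_of_tendsto {A : Set (Icc (0 : ℚ) 1)} {x : Icc (0 : ℝ) 1}
    (hx : Tendsto unitRatCast (cofinite ⊓ 𝓟 A) (𝓝 x)) : A ∈ convIdeal := by
  by_cases hA : A.Finite
  · exact mem_convIdeal_of_finite hA
  have : Infinite A := infinite_coe_iff.2 hA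
  obtain ⟨e⟩ : Nonempty (ℕ ≃ A) := nonempty_equiv_of_countable
  refine mem_convIdeal_iff.2 ⟨1, fun _ k => e k, fun _ => ⟨x, hx.comp (tendsto_inf.2 ⟨?_, ?_⟩)⟩, ?_⟩
  · rw [← Nat.cofinite_eq_atTop]
    exact (Subtype.val_injective.comp e.injective).tendsto_cofinite
  · exact tendsto_principal.2 (Eventually.of_forall fun k => (e k).2)
  · exact fun a ha => mem_iUnion.2 ⟨0, e.symm ⟨a, ha⟩, by simp only [Equiv.apply_symm_apply]⟩

theorem finite_derivedSet_of_mem_convIdeal {A : Set (Icc (0 : ℚ) 1)} (hA : A ∈ convIdeal) :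
    (derivedSet (unitRatCast '' A)).Finite := by
  obtain ⟨n, s, hs, hAs⟩ := mem_convIdeal_iff.1 hA
  choose p hp using hs
  refine (finite_range p).subset ?_
  calc derivedSet (unitRatCast '' A)
      ⊆ derivedSet (⋃ i, range (unitRatCast ∘ s i)) := by
        refine derivedSet_mono _ _ ((image_mono hAs).trans ?_)
        simp only [image_iUnion, range_comp, subset_rfl]
    _ = ⋃ i, derivedSet (range (unitRatCast ∘ s i)) := derivedSet_iUnion_of_finite _
    _ ⊆ range p := iUnion_subset fun i =>
        (derivedSet_range_subset_of_tendsto (hp i)).trans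
          (singleton_subset_iff.2 (mem_range_self i))

theorem exists_notMem_convIdeal_of_infinite_accPt {l : Filter (Icc (0 : ℚ) 1)}
    [l.IsCountablyGenerated] (hl : {x | AccPt x (map unitRatCast l)}.Infinite) :
    ∃ A ∉ convIdeal, cofinite ⊓ 𝓟 A ≤ l := by
  have x := hl.natEmbedding
  have hne (j : ℕ) : (comap unitRatCast (𝓝[≠] (x j).1) ⊓ l).NeBot := by
    rw [← map_neBot_iff unitRatCast, Filter.push_pull']
    exact (x j).2
  obtain ⟨A, hAl, hA⟩ := exists_cofinite_inf_principal_le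
    (m := fun j => comap unitRatCast (𝓝[≠] (x j).1) ⊓ l) fun j => inf_le_right
  refine ⟨A, fun hAconv => ?_, hAl⟩
  refine infinite_range_of_injective (Subtype.val_injective.comp x.injective)
    ((finite_derivedSet_of_mem_convIdeal hAconv).subset ?_)
  rintro _ ⟨j, rfl⟩
  have := ((hA j).mono (inf_le_inf_right _ inf_le_left)).map unitRatCast
  rwa [Filter.push_pull', map_principal] at this

end ConvIdeal

section TailFilter

variable {Ω Λ X Y : Type*} {𝓕 : Set (Set Ω)} {ρ : Set Ω → Set Λ} {E F : Set Ω}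

/-- The filter on `Λ` generated by the sets `ρ(F ∖ K)` with `K ⊆ Ω` finite. For `F ∈ 𝓕`,
`ρ`-convergence on `F` is convergence along it. -/
def tailFilter (ρ : Set Ω → Set Λ) (F : Set Ω) : Filter Λ :=
  ⨅ K : Finset Ω, 𝓟 (ρ (F \ (K : Set Ω)))

instance isCountablyGenerated_tailFilter [Countable Ω] (ρ : Set Ω → Set Λ) (F : Set Ω) :
    (tailFilter ρ F).IsCountablyGenerated :=
  inferInstanceAs (⨅ K : Finset Ω, 𝓟 (ρ (F \ (K : Set Ω)))).IsCountablyGenerated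

theorem tailFilter_le_principal (ρ : Set Ω → Set Λ) (F : Set Ω) : tailFilter ρ F ≤ 𝓟 (ρ F) :=
  (iInf_le _ ∅).trans_eq (by simp only [Finset.coe_empty, sdiff_empty])

namespace IsPartitionRegular

variable (hρ : IsPartitionRegular 𝓕 ρ)
include hρ

theorem hasBasis_tailFilter (hF : F ∈ 𝓕) :
    (tailFilter ρ F).HasBasis (fun _ : Finset Ω => True) fun K => ρ (F \ (K : Set Ω)) := by
  classical
  have hanti {K L : Finset Ω} (hKL : K ⊆ L) : ρ (F \ (L : Set Ω)) ⊆ ρ (F \ (K : Set Ω)) :=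
    hρ.mono _ (hρ.diff_mem F hF L) _ (hρ.diff_mem F hF K)
      (sdiff_subset_sdiff_right (Finset.coe_subset.2 hKL))
  exact hasBasis_iInf_principal fun K L =>
    ⟨K ∪ L, hanti Finset.subset_union_left, hanti Finset.subset_union_right⟩

theorem tailFilter_neBot (hF : F ∈ 𝓕) : (tailFilter ρ F).NeBot :=
  (hρ.hasBasis_tailFilter hF).neBot_iff.2 fun {K} _ =>
    (hρ.infinite_value _ (hρ.diff_mem F hF K)).nonempty

theorem tailFilter_mono (hE : E ∈ 𝓕) (hF : F ∈ 𝓕) (hEF : E ⊆ F) :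
    tailFilter ρ E ≤ tailFilter ρ F :=
  iInf_mono fun K => principal_mono.2 <|
    hρ.mono _ (hρ.diff_mem E hE K) _ (hρ.diff_mem F hF K) (sdiff_subset_sdiff_left hEF)

theorem exists_tailFilter_le_cofinite (hE : E ∈ 𝓕) :
    ∃ F ∈ 𝓕, F ⊆ E ∧ tailFilter ρ F ≤ cofinite := by
  obtain ⟨F, hF, hFE, hsparse⟩ := hρ.sparse E hE
  refine ⟨F, hF, hFE, le_cofinite_iff_compl_singleton_mem.2 fun a => ?_⟩
  by_cases ha : a ∈ ρ F
  · obtain ⟨K, hK⟩ := hsparse a ha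
    exact (hρ.hasBasis_tailFilter hF).mem_iff.2 ⟨K, trivial, subset_compl_singleton_iff.2 hK⟩
  · exact tailFilter_le_principal ρ F (subset_compl_singleton_iff.2 ha)

theorem rhoConvergesTo_iff_tendsto [TopologicalSpace X] (hF : F ∈ 𝓕) {f : Λ → X} {x : X} :
    RhoConvergesTo ρ f F x ↔ Tendsto f (tailFilter ρ F) (𝓝 x) := by
  simp only [RhoConvergesTo, tendsto_def, (hρ.hasBasis_tailFilter hF).mem_iff, true_and,
    image_subset_iff]

theorem finBW_iff_exists_tendsto [TopologicalSpace X] :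
    FinBW 𝓕 ρ X ↔ ∀ f : Λ → X, ∃ F ∈ 𝓕, ∃ x, Tendsto f (tailFilter ρ F) (𝓝 x) :=
  forall_congr' fun _ => exists_congr fun _ => and_congr_right fun hF =>
    exists_congr fun _ => hρ.rhoConvergesTo_iff_tendsto hF

theorem katetovLE_rhoOfIdeal_iff {I : Set (Set Y)} :
    KatetovLE (coideal I) (rhoOfIdeal I) 𝓕 ρ ↔
      ∃ f : Λ → Y, ∀ F ∈ 𝓕, ∃ A ∉ I, cofinite ⊓ 𝓟 A ≤ map f (tailFilter ρ F) := by
  refine exists_congr fun f => forall₂_congr fun F hF => exists_congr fun A => and_congr_right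
    fun _ => ?_
  simp only [((hρ.hasBasis_tailFilter hF).map f).ge_iff, mem_cofinite_inf_principal, forall_const]
  refine forall_congr' fun K => ⟨?_, fun hfin => ⟨hfin.toFinset, ?_⟩⟩
  · rintro ⟨L, hL⟩
    exact L.finite_toSet.subset (sdiff_subset_comm.1 hL)
  · rw [hfin.coe_toFinset]
    exact sdiff_subset_comm.1 subset_rfl

end IsPartitionRegular

end TailFilter

section FinBW

variable {Ω Λ : Type*} {𝓕 : Set (Set Ω)} {ρ : Set Ω → Set Λ}

theorem FinBW.of_surjective {X Y : Type*} [TopologicalSpace X] [TopologicalSpace Y]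
    (hX : FinBW 𝓕 ρ X) {g : X → Y} (hg : Continuous g) (hsurj : g.Surjective) : FinBW 𝓕 ρ Y := by
  intro f
  obtain ⟨F, hF, x, hx⟩ := hX (Function.surjInv hsurj ∘ f)
  refine ⟨F, hF, g x, fun U hU => ?_⟩
  obtain ⟨K, hK⟩ := hx _ (hg.continuousAt hU)
  refine ⟨K, image_subset_iff.2 fun a ha => ?_⟩
  have haU : g (Function.surjInv hsurj (f a)) ∈ U := hK (mem_image_of_mem _ ha)
  rwa [Function.surjInv_eq hsurj] at haU

namespace IsPartitionRegular

variable (hρ : IsPartitionRegular 𝓕 ρ)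
include hρ

theorem finBW_of_isClosedEmbedding {X Y : Type*} [TopologicalSpace X] [TopologicalSpace Y]
    (hY : FinBW 𝓕 ρ Y) {g : X → Y} (hg : IsClosedEmbedding g) : FinBW 𝓕 ρ X := by
  rw [hρ.finBW_iff_exists_tendsto] at hY ⊢
  intro f
  obtain ⟨F, hF, y, hy⟩ := hY (g ∘ f)
  have := hρ.tailFilter_neBot hF
  obtain ⟨x, rfl⟩ := hg.isClosed_range.mem_of_tendsto hy
    (Eventually.of_forall fun a => mem_range_self (f a))
  exact ⟨F, hF, x, hg.isInducing.tendsto_nhds_iff.2 hy⟩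

theorem compactSpace_of_finBW [Countable Λ] {X : Type*} [PseudoMetricSpace X]
    (hX : FinBW 𝓕 ρ X) : CompactSpace X := by
  rw [compactSpace_iff_seqCompactSpace]
  refine ⟨fun u _ => ?_⟩
  obtain ⟨e, he⟩ := exists_injective_nat Λ
  obtain ⟨E, hE, x, hx⟩ := hρ.finBW_iff_exists_tendsto.1 hX (u ∘ e)
  obtain ⟨F, hF, hFE, hcof⟩ := hρ.exists_tailFilter_le_cofinite hE
  have := hρ.tailFilter_neBot hF
  have he_atTop : Tendsto e (tailFilter ρ F) atTop :=
    Nat.cofinite_eq_atTop ▸ he.tendsto_cofinite.mono_left hcof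
  have hcluster : MapClusterPt x atTop u :=
    .of_comp he_atTop (hx.mono_left (hρ.tailFilter_mono hF hE hFE)).mapClusterPt
  obtain ⟨φ, hφ, hlim⟩ := hcluster.tendsto_subseq
  exact ⟨x, mem_univ x, φ, hφ, hlim⟩

theorem finBW_of_compactSpace (hI : FinBW 𝓕 ρ (Icc (0 : ℝ) 1)) (X : Type*) [MetricSpace X]
    [CompactSpace X] : FinBW 𝓕 ρ X := by
  rcases isEmpty_or_nonempty X with hX | hX
  · intro f
    obtain ⟨F, hF⟩ := hρ.nonempty
    obtain ⟨a, -⟩ := (hρ.infinite_value F hF).nonempty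
    exact hX.elim (f a)
  have hcantor : IsClosedEmbedding (inclusion cantorSet_subset_unitInterval) :=
    (IsClosedEmbedding.of_comp_iff isClosed_Icc.isClosedEmbedding_subtypeVal).1
      isClosed_cantorSet.isClosedEmbedding_subtypeVal
  obtain ⟨g, hg, hsurj⟩ := exists_nat_bool_continuous_surjective_of_compact X
  exact (hρ.finBW_of_isClosedEmbedding hI hcantor).of_surjective
    (hg.comp cantorSetHomeomorphNatToBool.continuous)
    (hsurj.comp cantorSetHomeomorphNatToBool.surjective)

theorem forall_finBW_iff_compactSpace_iff [Countable Λ] :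
    (∀ (X : Type w) [MetricSpace X], FinBW 𝓕 ρ X ↔ CompactSpace X) ↔
      FinBW 𝓕 ρ (Icc (0 : ℝ) 1) := by
  refine ⟨fun h => ?_, fun hI X _ =>
    ⟨hρ.compactSpace_of_finBW, fun _ => hρ.finBW_of_compactSpace hI X⟩⟩
  have hlift : FinBW 𝓕 ρ (ULift.{w} (Icc (0 : ℝ) 1)) := (h _).2 inferInstance
  exact hlift.of_surjective continuous_uliftDown ULift.down_surjective

theorem finBW_of_denseRange [Countable Λ] {X Y : Type*} [PseudoMetricSpace X] {i : Y → X}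
    (hi : DenseRange i)
    (h : ∀ g : Λ → Y, ∃ F ∈ 𝓕, ∃ x, Tendsto (i ∘ g) (tailFilter ρ F) (𝓝 x)) : FinBW 𝓕 ρ X := by
  refine hρ.finBW_iff_exists_tendsto.2 fun f => ?_
  obtain ⟨g, hg⟩ := exists_tendsto_dist_of_denseRange hi f
  obtain ⟨E, hE, x, hx⟩ := h g
  obtain ⟨F, hF, hFE, hcof⟩ := hρ.exists_tailFilter_le_cofinite hE
  exact ⟨F, hF, x, (tendsto_iff_of_dist (hg.mono_left hcof)).2
    (hx.mono_left (hρ.tailFilter_mono hF hE hFE))⟩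

theorem not_katetovLE_conv_of_finBW (hI : FinBW 𝓕 ρ (Icc (0 : ℝ) 1)) :
    ¬ KatetovLE (coideal convIdeal) (rhoOfIdeal convIdeal) 𝓕 ρ := by
  rw [hρ.katetovLE_rhoOfIdeal_iff]
  rintro ⟨g, hg⟩
  obtain ⟨F, hF, x, hx⟩ := hρ.finBW_iff_exists_tendsto.1 hI (unitRatCast ∘ g)
  obtain ⟨A, hA, hAF⟩ := hg F hF
  exact hA (mem_convIdeal_of_tendsto ((tendsto_map'_iff.2 hx).mono_left hAF))

end IsPartitionRegular

end FinBW

section DualFilter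

variable {Ω Λ X : Type*} {𝓕 : Set (Set Ω)} {ρ : Set Ω → Set Λ} {F : Set Ω} {A B : Set Λ}

theorem rhoIdeal_mono (hB : B ∈ rhoIdeal 𝓕 ρ) (hAB : A ⊆ B) : A ∈ rhoIdeal 𝓕 ρ :=
  fun F hF hFA => hB F hF (hFA.trans hAB)

theorem value_notMem_rhoIdeal (hF : F ∈ 𝓕) : ρ F ∉ rhoIdeal 𝓕 ρ :=
  fun h => h F hF subset_rfl

namespace IsPartitionRegular

theorem empty_mem_rhoIdeal (hρ : IsPartitionRegular 𝓕 ρ) : ∅ ∈ rhoIdeal 𝓕 ρ :=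
  fun F hF h => hρ.infinite_value F hF (finite_empty.subset h)

theorem union_mem_rhoIdeal (hρ : IsPartitionRegular 𝓕 ρ) (hA : A ∈ rhoIdeal 𝓕 ρ)
    (hB : B ∈ rhoIdeal 𝓕 ρ) : A ∪ B ∈ rhoIdeal 𝓕 ρ := by
  intro F hF h
  obtain ⟨E, hE, hEA | hEB⟩ := hρ.ramsey F hF (ρ F ∩ A) (ρ F ∩ B)
    (by rw [← inter_union_distrib_left, inter_eq_left.2 h])
  · exact hA E hE (hEA.trans inter_subset_right)
  · exact hB E hE (hEB.trans inter_subset_right)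

/-- The filter of complements of members of `I_ρ`. For `A ∉ I_ρ`, the filter `dualFilter ⊓ 𝓟 A`
expresses that a property holds on `A` outside a set in `I_ρ`. -/
def dualFilter (hρ : IsPartitionRegular 𝓕 ρ) : Filter Λ :=
  comk (· ∈ rhoIdeal 𝓕 ρ) hρ.empty_mem_rhoIdeal (fun _ hB _ hAB => rhoIdeal_mono hB hAB)
    fun _ hA _ hB => hρ.union_mem_rhoIdeal hA hB

variable (hρ : IsPartitionRegular 𝓕 ρ)

theorem mem_dualFilter_inf_principal : B ∈ hρ.dualFilter ⊓ 𝓟 A ↔ A \ B ∈ rhoIdeal 𝓕 ρ := by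
  have hcompl : {x | x ∈ A → x ∈ B}ᶜ = A \ B := by grind
  rw [mem_inf_principal, dualFilter, mem_comk, hcompl]

theorem dualFilter_inf_principal_neBot_iff :
    (hρ.dualFilter ⊓ 𝓟 A).NeBot ↔ A ∉ rhoIdeal 𝓕 ρ := by
  rw [neBot_iff, Ne, ← empty_mem_iff_bot, mem_dualFilter_inf_principal, sdiff_empty]

theorem dualFilter_inf_principal_le_tailFilter (hF : SetHasSmallAccretions 𝓕 ρ F) :
    hρ.dualFilter ⊓ 𝓟 (ρ F) ≤ tailFilter ρ F :=
  le_iInf fun K => le_principal_iff.2 (hρ.mem_dualFilter_inf_principal.2 (hF K))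

include hρ in
theorem exists_tailFilter_le_of_pMinus (hP : PMinus 𝓕 ρ) (hA : A ∉ rhoIdeal 𝓕 ρ) {l : Filter Λ}
    [l.IsCountablyGenerated] (hl : hρ.dualFilter ⊓ 𝓟 A ≤ l) : ∃ F ∈ 𝓕, tailFilter ρ F ≤ l := by
  obtain ⟨B, hB⟩ := l.exists_antitone_basis
  have hsmall (n : ℕ) : A \ B n ∈ rhoIdeal 𝓕 ρ :=
    hρ.mem_dualFilter_inf_principal.1 (hl (hB.mem n))
  obtain ⟨F, hF, -, htail⟩ := hP (fun n => A ∩ B n)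
    (fun m n hmn => inter_subset_inter_right A (hB.antitone hmn))
    (fun h => hA (rhoIdeal_mono (hρ.union_mem_rhoIdeal h (hsmall 0)) (inter_union_sdiff A _).ge))
    fun n => rhoIdeal_mono (hsmall (n + 1)) fun a ha => ⟨ha.1.1, fun h => ha.2 ⟨ha.1.1, h⟩⟩
  refine ⟨F, hF, hB.ge_iff.2 fun n _ => ?_⟩
  obtain ⟨K, hK⟩ := htail n
  exact (hρ.hasBasis_tailFilter hF).mem_iff.2 ⟨K, trivial, hK.trans inter_subset_right⟩

theorem exists_tendsto_of_finite_mapClusterPt (hP : PMinus 𝓕 ρ) [TopologicalSpace X]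
    [CompactSpace X] [T2Space X] [FirstCountableTopology X] {f : Λ → X} (hA : A ∉ rhoIdeal 𝓕 ρ)
    (hfin : {x | MapClusterPt x (hρ.dualFilter ⊓ 𝓟 A) f}.Finite) :
    ∃ E ∈ 𝓕, ∃ x, Tendsto f (tailFilter ρ E) (𝓝 x) := by
  have := hρ.dualFilter_inf_principal_neBot_iff.2 hA
  obtain ⟨c, V, hV, hVc⟩ := exists_inf_principal_le_nhds_of_finite_clusterPt hfin
  rw [← map_inf_principal_preimage, inf_assoc, inf_principal] at hV hVc
  have hpos : A ∩ f ⁻¹' V ∉ rhoIdeal 𝓕 ρ :=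
    hρ.dualFilter_inf_principal_neBot_iff.1 ((map_neBot_iff f).1 hV)
  obtain ⟨E, hE, hEc⟩ := hρ.exists_tailFilter_le_of_pMinus hP hpos (map_le_iff_le_comap.1 hVc)
  exact ⟨E, hE, c, tendsto_iff_comap.2 hEc⟩

theorem accPt_map_tailFilter_of_mapClusterPt [TopologicalSpace X] {f : Λ → X}
    (hf : ∀ E ∈ 𝓕, ∀ x, ¬ Tendsto f (tailFilter ρ E) (𝓝 x)) (hF : SetHasSmallAccretions 𝓕 ρ F)
    {x : X} (hx : MapClusterPt x (hρ.dualFilter ⊓ 𝓟 (ρ F)) f) :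
    AccPt x (map f (tailFilter ρ F)) := by
  have hfiber : f ⁻¹' {x} ∈ rhoIdeal 𝓕 ρ := fun E hE hEx =>
    hf E hE x <| (tendsto_pure.2 (tailFilter_le_principal ρ E hEx)).mono_right (pure_le_nhds x)
  have hne : map f (hρ.dualFilter ⊓ 𝓟 (ρ F)) ≤ 𝓟 {x}ᶜ :=
    le_principal_iff.2 <| mem_map.2 <| hρ.mem_dualFilter_inf_principal.2 <|
      rhoIdeal_mono hfiber fun a ha => not_not.1 ha.2
  refine accPt_iff_clusterPt.2 (hx.clusterPt.mono (le_inf hne (map_mono ?_)))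
  exact hρ.dualFilter_inf_principal_le_tailFilter hF

include hρ in
theorem finBW_of_not_katetovLE_conv [Countable Ω] [Countable Λ] (hacc : HasSmallAccretions 𝓕 ρ)
    (hP : PMinus 𝓕 ρ) (hconv : ¬ KatetovLE (coideal convIdeal) (rhoOfIdeal convIdeal) 𝓕 ρ) :
    FinBW 𝓕 ρ (Icc (0 : ℝ) 1) := by
  refine hρ.finBW_of_denseRange denseRange_unitRatCast fun g => ?_
  by_contra! hg
  refine hconv (hρ.katetovLE_rhoOfIdeal_iff.2 ⟨g, fun E hE => ?_⟩)
  obtain ⟨F, hF, hFE, hFacc⟩ := hacc E hE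
  have hinf : {x | MapClusterPt x (hρ.dualFilter ⊓ 𝓟 (ρ F)) (unitRatCast ∘ g)}.Infinite := by
    intro hfin
    obtain ⟨G, hG, x, hx⟩ :=
      hρ.exists_tendsto_of_finite_mapClusterPt hP (value_notMem_rhoIdeal hF) hfin
    exact hg G hG x hx
  obtain ⟨A, hA, hAF⟩ := exists_notMem_convIdeal_of_infinite_accPt (l := map g (tailFilter ρ F))
    (hinf.mono fun x hx => hρ.accPt_map_tailFilter_of_mapClusterPt hg hFacc hx)
  exact ⟨A, hA, hAF.trans (map_mono (hρ.tailFilter_mono hF hE hFE))⟩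

end IsPartitionRegular

end DualFilter

theorem mainTheorem5 {Ω : Type u} {Λ : Type v} [Countable Ω] [Infinite Ω]
    [Countable Λ] [Infinite Λ] (𝓕 : Set (Set Ω)) (ρ : Set Ω → Set Λ)
    (hρ : IsPartitionRegular 𝓕 ρ) (hacc : HasSmallAccretions 𝓕 ρ) :
    (PMinus 𝓕 ρ →
      List.TFAE
        [∀ (X : Type w) [MetricSpace X], FinBW 𝓕 ρ X ↔ CompactSpace X,
         FinBW 𝓕 ρ (Set.Icc (0 : ℝ) 1),
         ¬ KatetovLE (coideal convIdeal) (rhoOfIdeal convIdeal) 𝓕 ρ]) ∧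
    -- without assuming `P⁻`, only the implication from the third to the second condition is lost
    ((∀ (X : Type w) [MetricSpace X], FinBW 𝓕 ρ X ↔ CompactSpace X) ↔
      FinBW 𝓕 ρ (Set.Icc (0 : ℝ) 1)) ∧
    (FinBW 𝓕 ρ (Set.Icc (0 : ℝ) 1) →
      ¬ KatetovLE (coideal convIdeal) (rhoOfIdeal convIdeal) 𝓕 ρ) := by
  have h12 := hρ.forall_finBW_iff_compactSpace_iff
  refine ⟨fun hP => ?_, h12, hρ.not_katetovLE_conv_of_finBW⟩
  tfae_have 1 ↔ 2 := h12
  tfae_have 2 → 3 := hρ.not_katetovLE_conv_of_finBW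
  tfae_have 3 → 2 := hρ.finBW_of_not_katetovLE_conv hacc hP
  tfae_finish
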